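/- Let $n,M\ge 1$, and let $\mathbf Y\in\mathbb R^{n\times M}$ be a matrix of targets (columns = training examples, rows = tasks). Let $\bar{\mathbf Y}$ be the $n\times M$ matrix all of whose columns equal the mean of the columns of $\mathbf Y$, and assume that the sample covariance matrix $\mathbf\Sigma=M^{-1}(\mathbf Y-\bar{\mathbf Y})(\mathbf Y-\bar{\mathbf Y})^T$ has full rank $n$. Let $\lambda_{\max}=\lambda_1\ge\cdots\ge\lambda_n=\lambda_{\min}>0$ be its eigenvalues, and let $\sigma_1^2\ge\cdots\ge\sigma_n^2$ be its diagonal entries (the variances of the rows of $\mathbf Y$) in descending order. For a target matrix $\mathbf Z\in\mathbb R^{m\times M}$, a feature dimension $d$ and regularization parameters $\lambda_{\mathbf H},\lambda_{\mathbf W}\ge 0$, the unconstrained feature model (UFM) minimizes $$\mathcal L(\mathbf H,\mathbf W,\mathbf b)=\frac1{2M}\|\mathbf W\mathbf H+\mathbf b\mathbf 1_M^T-\mathbf Z\|_F^2+\frac{\lambda_{\mathbf H}}{2M}\|\mathbf H\|_F^2+\frac{\lambda_{\mathbf W}}2\|\mathbf W\|_F^2$$ over $\mathbf H\in\mathbb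 R^{d\times M}$, $\mathbf W\in\mathbb R^{m\times d}$, $\mathbf b\in\mathbb R^m$. The training MSE of $(\mathbf H,\mathbf W,\mathbf b)$ is $\frac1M\|\mathbf W\mathbf H+\mathbf b\mathbf 1_M^T-\mathbf Z\|_F^2$. Multi-task model: take $\mathbf Z=\mathbf Y$, a feature dimension $d\ge n$ and parameters $\lambda_{\mathbf H},\lambda_{\mathbf W}\ge0$, and put $c=\lambda_{\mathbf H}\lambda_{\mathbf W}$. Let $\mathrm{MSE}(\text{multi},c)$ be the training MSE of a global minimizer of the loss. Single-task models: for each $i=1,\dots,n$ take $\mathbf Z$ to be the $i$-th row of $\mathbf Y$, a feature dimension $d'\ge1$ and parameters $\tilde\lambda_{\mathbf H},\tilde\lambda_{\mathbf W}\ge0$ (the same for all $i$), and put $\tilde c=\tilde\lambda_{\mathbf H}\tilde\lambda_{\mathbf W}$. Let $\mathrm{MSE}(n\text{-single},\tilde c)$ be the sum over $i$ of the training MSEs of global minimizers of these $n$ losses. Put $j^*=\max\{j:\lambda_j\ge c\}$ and $k^*=\max\{j:\sigma_j^2\ge\tilde c\}$, where the maximum of the empty set is $0$. Then, for any choice of these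 global minimizers: **(i)** If $\tilde c=c$, then $\mathrm{MSE}(\text{multi},c)\le\mathrm{MSE}(n\text{-single},c)$. The inequality is strict if $\lambda_{\min}<c<\lambda_{\max}$ and $j^*<k^*$. It is an equality if $0<c<\lambda_{\min}$ or $c>\lambda_{\max}$. **(ii)** If $c<\tilde c$, then $\mathrm{MSE}(\text{multi},c)\le\mathrm{MSE}(n\text{-single},\tilde c)$. The inequality is strict if $c<\min\{\tilde c,\lambda_{\max}\}$. It is an equality if $\lambda_{\max}<c<\tilde c$. -/

import Mathlib

open scoped Matrix

noncomputable section

namespace UFM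

/-- The squared Frobenius norm of a real matrix. -/
def frobSq {p q : ℕ} (A : Matrix (Fin p) (Fin q) ℝ) : ℝ :=
  ∑ i, ∑ j, A i j ^ 2

/-- The residual `W H + b 1ᵀ - Y` of the unconstrained feature model (UFM). -/
def residual {n d M : ℕ} (Y : Matrix (Fin n) (Fin M) ℝ)
    (H : Matrix (Fin d) (Fin M) ℝ) (W : Matrix (Fin n) (Fin d) ℝ) (b : Fin n → ℝ) :
    Matrix (Fin n) (Fin M) ℝ :=
  W * H + Matrix.vecMulVec b (1 : Fin M → ℝ) - Y

/-- The UFM-loss with targets `Y` and regularization parameters `lamH`, `lamW`. -/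
def loss {n d M : ℕ} (lamH lamW : ℝ) (Y : Matrix (Fin n) (Fin M) ℝ)
    (H : Matrix (Fin d) (Fin M) ℝ) (W : Matrix (Fin n) (Fin d) ℝ) (b : Fin n → ℝ) : ℝ :=
  1 / (2 * (M : ℝ)) * frobSq (residual Y H W b)
    + lamH / (2 * (M : ℝ)) * frobSq H + lamW / 2 * frobSq W

/-- The training MSE of the UFM with targets `Y`. -/
def mse {n d M : ℕ} (Y : Matrix (Fin n) (Fin M) ℝ)
    (H : Matrix (Fin d) (Fin M) ℝ) (W : Matrix (Fin n) (Fin d) ℝ) (b : Fin n → ℝ) : ℝ :=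
  1 / (M : ℝ) * frobSq (residual Y H W b)

/-- `(H, W, b)` is an optimal solution, i.e. a global minimizer of the UFM-loss. -/
def IsOptimal {n d M : ℕ} (lamH lamW : ℝ) (Y : Matrix (Fin n) (Fin M) ℝ)
    (H : Matrix (Fin d) (Fin M) ℝ) (W : Matrix (Fin n) (Fin d) ℝ) (b : Fin n → ℝ) : Prop :=
  ∀ (H' : Matrix (Fin d) (Fin M) ℝ) (W' : Matrix (Fin n) (Fin d) ℝ) (b' : Fin n → ℝ),
    loss lamH lamW Y H W b ≤ loss lamH lamW Y H' W' b'

/-- The targets of the `i`-th univariate problem: the `i`-th row of `Y`, as a `1 × M` matrix. -/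
def taskTargets {n M : ℕ} (Y : Matrix (Fin n) (Fin M) ℝ) (i : Fin n) :
    Matrix (Fin 1) (Fin M) ℝ :=
  Matrix.of fun _ j => Y i j

/-- The mean of the `i`-th target dimension over the `M` training examples. -/
def targetMean {n M : ℕ} (Y : Matrix (Fin n) (Fin M) ℝ) (i : Fin n) : ℝ :=
  (M : ℝ)⁻¹ * ∑ j, Y i j

/-- The centred target matrix `Y - Ȳ`. -/
def centered {n M : ℕ} (Y : Matrix (Fin n) (Fin M) ℝ) : Matrix (Fin n) (Fin M) ℝ :=
  Matrix.of fun i j => Y i j - targetMean Y i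

/-- The sample covariance matrix `Σ = M⁻¹ (Y - Ȳ) (Y - Ȳ)ᵀ` of the targets. -/
def sampleCov {n M : ℕ} (Y : Matrix (Fin n) (Fin M) ℝ) : Matrix (Fin n) (Fin n) ℝ :=
  (M : ℝ)⁻¹ • (centered Y * (centered Y)ᵀ)

theorem sampleCov_isHermitian {n M : ℕ} (Y : Matrix (Fin n) (Fin M) ℝ) :
    (sampleCov Y).IsHermitian := by
  unfold sampleCov Matrix.IsHermitian
  simp [Matrix.conjTranspose_eq_transpose_of_trivial, Matrix.transpose_mul]

/-- The variance of the targets of the `i`-th univariate problem. -/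
def taskVariance {n M : ℕ} (Y : Matrix (Fin n) (Fin M) ℝ) (i : Fin n) : ℝ :=
  (M : ℝ)⁻¹ * ∑ j, (Y i j - targetMean Y i) ^ 2

/-- The entries of `f`, with multiplicity, rearranged in descending order. -/
def sortDesc {n : ℕ} (f : Fin n → ℝ) : Fin n → ℝ :=
  fun i => f (Tuple.sort f (Fin.rev i))

theorem sortDesc_antitone {n : ℕ} (f : Fin n → ℝ) : Antitone (sortDesc f) :=
  fun _ _ h => Tuple.monotone_sort f (Fin.rev_le_rev.mpr h)

/-- The eigenvalues `λ₁ ≥ λ₂ ≥ ⋯ ≥ λₙ` of the sample covariance matrix, with multiplicity. -/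
def eigs {n M : ℕ} (Y : Matrix (Fin n) (Fin M) ℝ) : Fin n → ℝ :=
  sortDesc (sampleCov_isHermitian Y).eigenvalues

/-- The task variances in descending order, `σ₁² ≥ σ₂² ≥ ⋯ ≥ σₙ²`. -/
def sortedVariances {n M : ℕ} (Y : Matrix (Fin n) (Fin M) ℝ) : Fin n → ℝ :=
  sortDesc (taskVariance Y)

/-- `max {j ∈ {1, …, n} : a_j ≥ t}`, with value `0` if the set is empty. The entry `a_j` is
`a i` with `j = i + 1`. -/
def lastIndexGE {n : ℕ} (a : Fin n → ℝ) (t : ℝ) : ℕ :=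
  (Finset.univ.filter fun i => t ≤ a i).sup fun i => (i : ℕ) + 1

end UFM

end

namespace UFM

open Matrix

/-! Everything follows from a formula for the training error of a global minimizer: it is `∑
min(λ_k, c)`, each eigenvalue of the covariance `Σ` truncated at `c`. A single task has `1 × 1`
covariance `σ_i²`, so it contributes `min(σ_i², ct)`.

For the formula, let `R` be the residual and `S = M⁻¹ R Rᵀ`, whose trace is the error. If `lamH >
0`, stationarity gives `S W = c W` and `Σ = T + S` with `T = W (⋯) Wᵀ` positive semidefinite, hence
`S T = c T`. Global minimality gives `S ≤ c` as quadratic forms. These relations force `S` to act on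
each eigenvector of `Σ` by `min(λ, c)` (`trace_eq_sum_min_of_complementary`). If `lamH = 0`, then `c
= 0` and the error vanishes, because exact fits have arbitrarily small penalty.

The variances are the diagonal of `Σ`, so they are doubly stochastic averages of its eigenvalues,
and concavity of `min(·, c)` compares the two sums. The strict cases come from the equality case of
this comparison and from monotonicity in the threshold. -/

/-! ### Spectral truncation -/

theorem exists_orthogonal_diagonalization {n : ℕ} {A : Matrix (Fin n) (Fin n) ℝ}
    (hA : A.IsHermitian) :
    ∃ U : Matrix (Fin n) (Fin n) ℝ, U * Uᵀ = 1 ∧ Uᵀ * U = 1 ∧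
      A = U * diagonal hA.eigenvalues * Uᵀ := by
  have hs : (star (hA.eigenvectorUnitary : Matrix (Fin n) (Fin n) ℝ)) =
      (hA.eigenvectorUnitary : Matrix (Fin n) (Fin n) ℝ)ᵀ := by
    rw [star_eq_conjTranspose, conjTranspose_eq_transpose_of_trivial]
  refine ⟨hA.eigenvectorUnitary, ?_, ?_, ?_⟩
  · rw [← hs]; exact Unitary.coe_mul_star_self _
  · rw [← hs]; exact Unitary.coe_star_mul_self _
  · rw [← hs]
    conv_lhs => rw [hA.spectral_theorem, Unitary.conjStarAlgAut_apply]
    rfl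

/-- If `A = T + S` with `T` and `c - S` positive semidefinite with product zero, then the
eigenvalues of `S` are those of `A`, truncated at `c`. -/
theorem trace_eq_sum_min_of_complementary {n : ℕ} {A T S : Matrix (Fin n) (Fin n) ℝ} {c : ℝ}
    (hA : A.IsHermitian) (hsum : A = T + S) (hTt : Tᵀ = T) (hSt : Sᵀ = S)
    (hT : ∀ v, 0 ≤ v ⬝ᵥ T *ᵥ v) (hS : ∀ v, v ⬝ᵥ S *ᵥ v ≤ c * (v ⬝ᵥ v))
    (hST : S * T = c • T) :
    S.trace = ∑ k, min (hA.eigenvalues k) c := by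
  obtain ⟨U, hUU, hUU', hAU⟩ := exists_orthogonal_diagonalization hA
  have hTS : T * S = c • T := by
    have := congrArg transpose hST
    rwa [transpose_mul, transpose_smul, hTt, hSt] at this
  have key : ∀ k, S *ᵥ Uᵀ k = min (hA.eigenvalues k) c • Uᵀ k := by
    intro k
    set l := hA.eigenvalues k
    set u := Uᵀ k
    have hAu : A *ᵥ u = l • u := by
      have h1 : A * U = U * diagonal hA.eigenvalues := by
        conv_lhs => rw [hAU]
        rw [Matrix.mul_assoc, hUU', Matrix.mul_one]
      ext i
      have h2 := congrFun (congrFun h1 i) k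
      rw [mul_diagonal] at h2
      rw [Pi.smul_apply, smul_eq_mul, mul_comm]
      exact h2
    have hTu : T *ᵥ u = l • u - S *ᵥ u := by
      rw [← hAu, hsum, add_mulVec, add_sub_cancel_right]
    have hTTu : T *ᵥ (T *ᵥ u) = (l - c) • T *ᵥ u := by
      have h1 : T *ᵥ (T *ᵥ u) = T *ᵥ (l • u - S *ᵥ u) := by rw [hTu]
      rw [h1, mulVec_sub, mulVec_smul, mulVec_mulVec, hTS, smul_mulVec, sub_smul]
    have hsymm : ∀ {B : Matrix (Fin n) (Fin n) ℝ}, Bᵀ = B → ∀ v w,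
        (B *ᵥ v) ⬝ᵥ w = v ⬝ᵥ B *ᵥ w := by
      intro B hB v w
      rw [dotProduct_mulVec, ← mulVec_transpose, hB]
    rcases le_or_gt c l with h | h
    · rw [min_eq_right h]
      have hSTu : S *ᵥ (T *ᵥ u) = c • T *ᵥ u := by
        rw [mulVec_mulVec, hST, smul_mulVec]
      -- The goal is `w = 0`. Since `S w = l w`, symmetry gives `w·w = (c - l)(u·w)`, where `c ≤ l`
      -- and `u·w ≥ 0` because `S ≤ c`.
      set w := c • u - S *ᵥ u with hw
      have hSw : S *ᵥ w = l • w := by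
        have h1 : S *ᵥ (T *ᵥ u) = l • S *ᵥ u - S *ᵥ (S *ᵥ u) := by
          rw [hTu, mulVec_sub, mulVec_smul]
        have h2 : S *ᵥ (S *ᵥ u) = l • S *ᵥ u - c • (l • u - S *ᵥ u) := by
          rw [← hTu, ← hSTu, h1]; abel
        rw [hw, mulVec_sub, mulVec_smul, h2]
        module
      have h0 : w ⬝ᵥ w = (c * (u ⬝ᵥ w) - l * (u ⬝ᵥ w)) := by
        nth_rw 1 [hw]
        rw [sub_dotProduct, smul_dotProduct, hsymm hSt, hSw, dotProduct_smul]
        rfl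
      have h3 : 0 ≤ u ⬝ᵥ w := by
        rw [hw, dotProduct_sub, dotProduct_smul, smul_eq_mul]
        linarith [hS u]
      have h4 : w ⬝ᵥ w ≤ 0 := by nlinarith
      have h5 : w = 0 := by
        rw [← dotProduct_self_eq_zero]
        exact le_antisymm h4 (by
          rw [dotProduct]; exact Finset.sum_nonneg fun i _ => mul_self_nonneg _)
      rw [hw, sub_eq_zero] at h5
      exact h5.symm
    · rw [min_eq_left h.le]
      -- `|T u|² = (l - c)(u·T u)`, a negative factor times a nonnegative one.
      have h4 : (T *ᵥ u) ⬝ᵥ (T *ᵥ u) ≤ 0 := by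
        rw [hsymm hTt, hTTu, dotProduct_smul, smul_eq_mul]
        nlinarith [hT u]
      have h5 : T *ᵥ u = 0 := by
        rw [← dotProduct_self_eq_zero]
        exact le_antisymm h4 (by
          rw [dotProduct]; exact Finset.sum_nonneg fun i _ => mul_self_nonneg _)
      rw [hTu, sub_eq_zero] at h5
      exact h5.symm
  have hSU : S * U = U * diagonal fun k => min (hA.eigenvalues k) c := by
    ext i k
    have h1 := congrFun (key k) i
    rw [Pi.smul_apply, smul_eq_mul, mul_comm] at h1
    rw [mul_diagonal]
    exact h1
  calc S.trace = (S * U * Uᵀ).trace := by rw [Matrix.mul_assoc, hUU, Matrix.mul_one]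
    _ = _ := by
      rw [hSU, trace_mul_comm, ← Matrix.mul_assoc, hUU', Matrix.one_mul, trace_diagonal]

/-! ### Comparison of the diagonal with the spectrum -/

/-- The diagonal of a Hermitian matrix arises from its eigenvalues by a doubly stochastic
matrix. -/
theorem exists_doublyStochastic_diag_eq {n : ℕ} {A : Matrix (Fin n) (Fin n) ℝ}
    (hA : A.IsHermitian) :
    ∃ p : Fin n → Fin n → ℝ, (∀ i k, 0 ≤ p i k) ∧ (∀ i, ∑ k, p i k = 1) ∧
      (∀ k, ∑ i, p i k = 1) ∧ ∀ i, A i i = ∑ k, p i k * hA.eigenvalues k := by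
  obtain ⟨U, hUU, hUU', hAU⟩ := exists_orthogonal_diagonalization hA
  refine ⟨fun i k => U i k ^ 2, fun i k => sq_nonneg _, fun i => ?_, fun k => ?_, fun i => ?_⟩
  · have := congrFun (congrFun hUU i) i
    rw [mul_apply, one_apply_eq] at this
    rw [← this]
    exact Finset.sum_congr rfl fun k _ => sq _
  · have := congrFun (congrFun hUU' k) k
    rw [mul_apply, one_apply_eq] at this
    rw [← this]
    exact Finset.sum_congr rfl fun k _ => sq _
  · conv_lhs => rw [hAU]
    rw [mul_apply]
    exact Finset.sum_congr rfl fun k _ => by rw [transpose_apply, mul_diagonal]; ring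

section Majorization

variable {n : ℕ} {a l : Fin n → ℝ} {p : Fin n → Fin n → ℝ}

/-- Jensen's inequality for the concave function `min(·, c)`, with the weights of row `i`. -/
theorem sum_mul_min_le (hp : ∀ i k, 0 ≤ p i k) (hrow : ∀ i, ∑ k, p i k = 1)
    (ha : ∀ i, a i = ∑ k, p i k * l k) (c : ℝ) (i : Fin n) :
    ∑ k, p i k * min (l k) c ≤ min (a i) c := by
  refine le_min ?_ ?_
  · rw [ha]
    exact Finset.sum_le_sum fun k _ => mul_le_mul_of_nonneg_left (min_le_left _ _) (hp i k)
  · calc ∑ k, p i k * min (l k) c ≤ ∑ k, p i k * c :=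
        Finset.sum_le_sum fun k _ => mul_le_mul_of_nonneg_left (min_le_right _ _) (hp i k)
      _ = c := by rw [← Finset.sum_mul, hrow, one_mul]

theorem sum_sum_mul_eq (hcol : ∀ k, ∑ i, p i k = 1) (f : Fin n → ℝ) :
    ∑ i, ∑ k, p i k * f k = ∑ k, f k := by
  rw [Finset.sum_comm]
  exact Finset.sum_congr rfl fun k _ => by rw [← Finset.sum_mul, hcol, one_mul]

theorem sum_min_le_sum_min (hp : ∀ i k, 0 ≤ p i k) (hrow : ∀ i, ∑ k, p i k = 1)
    (hcol : ∀ k, ∑ i, p i k = 1) (ha : ∀ i, a i = ∑ k, p i k * l k) (c : ℝ) :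
    ∑ k, min (l k) c ≤ ∑ i, min (a i) c := by
  rw [← sum_sum_mul_eq hcol]
  exact Finset.sum_le_sum fun i _ => sum_mul_min_le hp hrow ha c i

/-- Equality makes Jensen tight in every row, so a row with `a i ≥ c` puts no weight on columns with
`l k < c`. Such rows carry mass one each, all of it in columns with `l k ≥ c`, and each column holds
mass at most one from them. -/
theorem card_le_card_of_sum_min_eq (hp : ∀ i k, 0 ≤ p i k) (hrow : ∀ i, ∑ k, p i k = 1)
    (hcol : ∀ k, ∑ i, p i k = 1) (ha : ∀ i, a i = ∑ k, p i k * l k) {c : ℝ}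
    (h : ∑ k, min (l k) c = ∑ i, min (a i) c) :
    (Finset.univ.filter fun i => c ≤ a i).card ≤ (Finset.univ.filter fun k => c ≤ l k).card := by
  rw [← sum_sum_mul_eq hcol,
    Finset.sum_eq_sum_iff_of_le fun i _ => sum_mul_min_le hp hrow ha c i] at h
  have hzero : ∀ i, c ≤ a i → ∀ k, l k < c → p i k = 0 := by
    intro i hi k hk
    have h1 : ∑ k, p i k * min (l k) c = ∑ k, p i k * c := by
      rw [h i (Finset.mem_univ i), min_eq_right hi, ← Finset.sum_mul, hrow, one_mul]
    rw [Finset.sum_eq_sum_iff_of_le fun k _ =>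
      mul_le_mul_of_nonneg_left (min_le_right _ _) (hp i k)] at h1
    have h2 := h1 k (Finset.mem_univ k)
    rw [min_eq_left hk.le] at h2
    by_contra hne
    exact hk.ne (mul_left_cancel₀ hne h2)
  have hone : ∀ i, c ≤ a i → ∑ k with c ≤ l k, p i k = 1 := by
    intro i hi
    rw [← hrow i, Finset.sum_filter]
    refine Finset.sum_congr rfl fun k _ => ?_
    split_ifs with hk
    · rfl
    · exact (hzero i hi k (not_le.mp hk)).symm
  have : ((Finset.univ.filter fun i => c ≤ a i).card : ℝ) ≤
      (Finset.univ.filter fun k => c ≤ l k).card := by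
    calc ((Finset.univ.filter fun i => c ≤ a i).card : ℝ)
        = ∑ i with c ≤ a i, ∑ k with c ≤ l k, p i k := by
          rw [Finset.sum_congr rfl fun i hi => hone i (Finset.mem_filter.mp hi).2]
          simp
      _ = ∑ k with c ≤ l k, ∑ i with c ≤ a i, p i k := Finset.sum_comm
      _ ≤ ∑ k with c ≤ l k, ∑ i, p i k :=
          Finset.sum_le_sum fun k _ => Finset.sum_le_sum_of_subset_of_nonneg
            (Finset.filter_subset _ _) fun i _ _ => hp i k
      _ = _ := by rw [Finset.sum_congr rfl fun k _ => hcol k]; simp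
  exact_mod_cast this

end Majorization

/-! ### Sorted sequences -/

theorem card_filter_sortDesc {n : ℕ} (f : Fin n → ℝ) (t : ℝ) :
    (Finset.univ.filter fun i => t ≤ sortDesc f i).card =
      (Finset.univ.filter fun i => t ≤ f i).card :=
  Finset.card_equiv (Fin.revPerm.trans (Tuple.sort f)) fun i => by
    rw [Finset.mem_filter, Finset.mem_filter]
    exact ⟨fun h => ⟨Finset.mem_univ _, h.2⟩, fun h => ⟨Finset.mem_univ _, h.2⟩⟩

/-- In a descending sequence the entries `≥ t` form an initial segment, so the last one-based index
equals their number. -/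
theorem lastIndexGE_sortDesc {n : ℕ} (f : Fin n → ℝ) (t : ℝ) :
    lastIndexGE (sortDesc f) t = (Finset.univ.filter fun i => t ≤ f i).card := by
  have hset : ∀ i : Fin n, t ≤ sortDesc f i ↔ (i : ℕ) < lastIndexGE (sortDesc f) t := by
    intro i
    rw [lastIndexGE, Finset.lt_sup_iff]
    constructor
    · exact fun h => ⟨i, by simpa using h, Nat.lt_succ_self _⟩
    · rintro ⟨j, hj, hij⟩
      exact (Finset.mem_filter.mp hj).2.trans
        (sortDesc_antitone f (Fin.le_def.mpr (Nat.lt_succ_iff.mp hij)))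
  have hle : lastIndexGE (sortDesc f) t ≤ n := Finset.sup_le fun i _ => i.2
  rw [← card_filter_sortDesc, Finset.filter_congr fun i _ => hset i,
    Fin.card_filter_val_lt, min_eq_right hle]

theorem le_sortDesc_zero {n : ℕ} (hn : 0 < n) (f : Fin n → ℝ) (k : Fin n) :
    f k ≤ sortDesc f ⟨0, hn⟩ := by
  have h : sortDesc f (Fin.rev ((Tuple.sort f).symm k)) = f k := by simp [sortDesc]
  rw [← h]
  exact sortDesc_antitone f (Fin.le_def.mpr (Nat.zero_le _))

theorem sortDesc_last_le {n : ℕ} (hn : 0 < n) (f : Fin n → ℝ) (k : Fin n) :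
    sortDesc f ⟨n - 1, Nat.sub_lt hn Nat.one_pos⟩ ≤ f k := by
  have h : sortDesc f (Fin.rev ((Tuple.sort f).symm k)) = f k := by simp [sortDesc]
  rw [← h]
  exact sortDesc_antitone f (Fin.le_def.mpr (Nat.le_sub_one_of_lt (Fin.is_lt _)))

end UFM

namespace UFM

open Matrix

/-! ### The loss and its variations -/

theorem frobSq_eq_trace {p q : ℕ} (A : Matrix (Fin p) (Fin q) ℝ) :
    frobSq A = (A * Aᵀ).trace := by
  simp [frobSq, trace, mul_apply, sq]

theorem frobSq_nonneg {p q : ℕ} (A : Matrix (Fin p) (Fin q) ℝ) : 0 ≤ frobSq A :=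
  Finset.sum_nonneg fun _ _ => Finset.sum_nonneg fun _ _ => sq_nonneg _

theorem frobSq_eq_zero {p q : ℕ} {A : Matrix (Fin p) (Fin q) ℝ} (h : frobSq A = 0) : A = 0 := by
  ext i j
  have h1 := (Finset.sum_eq_zero_iff_of_nonneg fun i _ => Finset.sum_nonneg fun j _ =>
    sq_nonneg (A i j)).mp h i (Finset.mem_univ i)
  exact pow_eq_zero_iff two_ne_zero |>.mp ((Finset.sum_eq_zero_iff_of_nonneg fun j _ =>
    sq_nonneg (A i j)).mp h1 j (Finset.mem_univ j))

theorem frobSq_add {p q : ℕ} (A B : Matrix (Fin p) (Fin q) ℝ) :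
    frobSq (A + B) = frobSq A + 2 * (A * Bᵀ).trace + frobSq B := by
  have h : (B * Aᵀ).trace = (A * Bᵀ).trace := by
    rw [← trace_transpose, transpose_mul, transpose_transpose]
  simp only [frobSq_eq_trace, transpose_add, Matrix.mul_add, Matrix.add_mul, trace_add, h]
  ring

theorem frobSq_smul {p q : ℕ} (t : ℝ) (A : Matrix (Fin p) (Fin q) ℝ) :
    frobSq (t • A) = t ^ 2 * frobSq A := by
  simp [frobSq, mul_pow, Finset.mul_sum]

@[simp]
theorem frobSq_zero {p q : ℕ} : frobSq (0 : Matrix (Fin p) (Fin q) ℝ) = 0 := by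
  simp [frobSq]

theorem frobSq_vecMulVec {p q : ℕ} (v : Fin p → ℝ) (w : Fin q → ℝ) :
    frobSq (vecMulVec v w) = (v ⬝ᵥ v) * (w ⬝ᵥ w) := by
  simp only [frobSq, vecMulVec_apply, dotProduct, Finset.sum_mul_sum]
  exact Finset.sum_congr rfl fun i _ => Finset.sum_congr rfl fun j _ => by ring

theorem trace_mul_transpose_vecMulVec {p q : ℕ} (A : Matrix (Fin p) (Fin q) ℝ)
    (v : Fin p → ℝ) (w : Fin q → ℝ) :
    (A * (vecMulVec v w)ᵀ).trace = v ⬝ᵥ A *ᵥ w := by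
  simp only [trace, diag_apply, mul_apply, transpose_apply, vecMulVec_apply, dotProduct, mulVec,
    Finset.mul_sum]
  exact Finset.sum_congr rfl fun i _ => Finset.sum_congr rfl fun j _ => by ring

/-- First-order condition without derivatives: `t = -a / (|B| + 1)` makes the expression negative
unless `a = 0`. -/
theorem eq_zero_of_forall_nonneg {a B : ℝ} (h : ∀ t : ℝ, 0 ≤ t * a + t ^ 2 * B) : a = 0 := by
  have hs : 0 < |B| + 1 := by positivity
  have h1 := h (-a / (|B| + 1))
  have h2 : (-a / (|B| + 1) * a + (-a / (|B| + 1)) ^ 2 * B) * (|B| + 1) ^ 2 =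
      a ^ 2 * (B - |B| - 1) := by
    field_simp
    ring
  have h3 : 0 ≤ a ^ 2 * (B - |B| - 1) := h2 ▸ mul_nonneg h1 (sq_nonneg _)
  have h4 : a ^ 2 ≤ 0 := by nlinarith [le_abs_self B, sq_nonneg a]
  exact pow_eq_zero_iff two_ne_zero |>.mp (le_antisymm h4 (sq_nonneg a))

/-- Second-order analogue: if `a < 0`, choose `t² = -a / (|B| + 1)`. -/
theorem nonneg_of_forall_nonneg {a B : ℝ} (h : ∀ t : ℝ, 0 ≤ t ^ 2 * a + t ^ 4 * B) :
    0 ≤ a := by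
  by_contra ha
  rw [not_le] at ha
  have hs : 0 < |B| + 1 := by positivity
  have ht : Real.sqrt (-a / (|B| + 1)) ^ 2 = -a / (|B| + 1) :=
    Real.sq_sqrt (div_nonneg (by linarith) hs.le)
  have h1 := h (Real.sqrt (-a / (|B| + 1)))
  rw [show (4 : ℕ) = 2 * 2 from rfl, pow_mul, ht] at h1
  have h2 : (-a / (|B| + 1) * a + (-a / (|B| + 1)) ^ 2 * B) * (|B| + 1) ^ 2 =
      a ^ 2 * (B - |B| - 1) := by
    field_simp
    ring
  have h3 : 0 ≤ a ^ 2 * (B - |B| - 1) := h2 ▸ mul_nonneg h1 (sq_nonneg _)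
  nlinarith [le_abs_self B, sq_pos_of_neg ha]

section Variation

variable {n d M : ℕ} {lamH lamW : ℝ} {Y : Matrix (Fin n) (Fin M) ℝ}
  {H : Matrix (Fin d) (Fin M) ℝ} {W : Matrix (Fin n) (Fin d) ℝ} {b : Fin n → ℝ}

theorem residual_add (F : Matrix (Fin d) (Fin M) ℝ) (E : Matrix (Fin n) (Fin d) ℝ)
    (e : Fin n → ℝ) :
    residual Y (H + F) (W + E) (b + e) =
      residual Y H W b + (W * F + E * H + E * F + vecMulVec e 1) := by
  simp only [residual, Matrix.mul_add, Matrix.add_mul, add_vecMulVec]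
  abel

theorem IsOptimal.variation_nonneg (h : IsOptimal lamH lamW Y H W b)
    (F : Matrix (Fin d) (Fin M) ℝ) (E : Matrix (Fin n) (Fin d) ℝ) (e : Fin n → ℝ)
    {D : Matrix (Fin n) (Fin M) ℝ} (hD : W * F + E * H + E * F + vecMulVec e 1 = D) :
    0 ≤ 1 / (2 * (M : ℝ)) * (2 * (residual Y H W b * Dᵀ).trace + frobSq D)
      + lamH / (2 * (M : ℝ)) * (2 * (H * Fᵀ).trace + frobSq F)
      + lamW / 2 * (2 * (W * Eᵀ).trace + frobSq E) := by
  have h1 := h (H + F) (W + E) (b + e)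
  simp only [loss, residual_add, hD, frobSq_add] at h1
  linarith

/-- Stationarity in `W`. Perturbing along the gradient `G` itself makes the linear coefficient `M⁻¹
|G|²`. The conditions in `H` and `b` are obtained in the same way. -/
theorem IsOptimal.residual_mul_transpose (h : IsOptimal lamH lamW Y H W b) (hM : 0 < M) :
    residual Y H W b * Hᵀ = -((M : ℝ) * lamW) • W := by
  have hM' : (M : ℝ) ≠ 0 := Nat.cast_ne_zero.mpr hM.ne'
  set R := residual Y H W b with hR
  set G := R * Hᵀ + ((M : ℝ) * lamW) • W with hG
  suffices hz : G = 0 by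
    rw [neg_smul]; exact eq_neg_of_add_eq_zero_left hz
  refine frobSq_eq_zero ?_
  have h2 : frobSq G = (R * (G * H)ᵀ).trace + (M : ℝ) * lamW * (W * Gᵀ).trace := by
    rw [frobSq_eq_trace]
    nth_rw 1 [hG]
    rw [Matrix.add_mul, trace_add, Matrix.smul_mul, trace_smul, transpose_mul, Matrix.mul_assoc,
      smul_eq_mul]
  have h3 : (M : ℝ)⁻¹ * frobSq G = 0 := by
    refine eq_zero_of_forall_nonneg
      (B := 1 / (2 * (M : ℝ)) * frobSq (G * H) + lamW / 2 * frobSq G) fun t => ?_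
    have h1 := h.variation_nonneg 0 (t • G) 0 (D := t • (G * H)) (by simp)
    simp only [transpose_smul, Matrix.mul_smul, trace_smul, frobSq_smul, smul_eq_mul, transpose_zero,
      Matrix.mul_zero, trace_zero, frobSq_zero, ← hR] at h1
    convert h1 using 1
    rw [h2]
    field_simp
    ring
  exact (mul_eq_zero.mp h3).resolve_left (inv_ne_zero hM')

theorem IsOptimal.transpose_mul_residual (h : IsOptimal lamH lamW Y H W b) (hM : 0 < M) :
    Wᵀ * residual Y H W b = -lamH • H := by
  have hM' : (M : ℝ) ≠ 0 := Nat.cast_ne_zero.mpr hM.ne'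
  set R := residual Y H W b with hR
  set G := Wᵀ * R + lamH • H with hG
  suffices hz : G = 0 by
    rw [neg_smul]; exact eq_neg_of_add_eq_zero_left hz
  refine frobSq_eq_zero ?_
  have h2 : frobSq G = (R * (W * G)ᵀ).trace + lamH * (H * Gᵀ).trace := by
    rw [frobSq_eq_trace]
    nth_rw 1 [hG]
    rw [Matrix.add_mul, trace_add, Matrix.smul_mul, trace_smul, transpose_mul, Matrix.mul_assoc,
      trace_mul_comm, Matrix.mul_assoc, smul_eq_mul]
  have h3 : (M : ℝ)⁻¹ * frobSq G = 0 := by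
    refine eq_zero_of_forall_nonneg
      (B := 1 / (2 * (M : ℝ)) * frobSq (W * G) + lamH / (2 * (M : ℝ)) * frobSq G) fun t => ?_
    have h1 := h.variation_nonneg (t • G) 0 0 (D := t • (W * G)) (by simp)
    simp only [transpose_smul, Matrix.mul_smul, trace_smul, frobSq_smul, smul_eq_mul, transpose_zero,
      Matrix.mul_zero, trace_zero, frobSq_zero, ← hR] at h1
    convert h1 using 1
    rw [h2]
    field_simp
    ring
  exact (mul_eq_zero.mp h3).resolve_left (inv_ne_zero hM')

theorem IsOptimal.residual_mulVec_one (h : IsOptimal lamH lamW Y H W b) (hM : 0 < M) :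
    residual Y H W b *ᵥ 1 = 0 := by
  have hM' : (M : ℝ) ≠ 0 := Nat.cast_ne_zero.mpr hM.ne'
  set R := residual Y H W b with hR
  rw [← dotProduct_self_eq_zero]
  have h3 : (M : ℝ)⁻¹ * ((R *ᵥ 1) ⬝ᵥ (R *ᵥ 1)) = 0 := by
    refine eq_zero_of_forall_nonneg
      (B := 1 / (2 * (M : ℝ)) * frobSq (vecMulVec (R *ᵥ 1) (1 : Fin M → ℝ))) fun t => ?_
    have h1 := h.variation_nonneg 0 0 (t • (R *ᵥ 1)) (D := t • vecMulVec (R *ᵥ 1) 1)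
      (by simp)
    simp only [transpose_smul, Matrix.mul_smul, trace_smul, frobSq_smul, smul_eq_mul, transpose_zero,
      Matrix.mul_zero, trace_zero, frobSq_zero, trace_mul_transpose_vecMulVec, ← hR] at h1
    convert h1 using 1
    field_simp
    ring
  exact (mul_eq_zero.mp h3).resolve_left (inv_ne_zero hM')

/-- The second-order condition in a direction in which `W` has a kernel. -/
theorem IsOptimal.residual_le_of_mulVec_eq_zero (h : IsOptimal lamH lamW Y H W b) (hM : 0 < M)
    (hlamH : 0 < lamH) {a : Fin d → ℝ} (ha : a ≠ 0) (hWa : W *ᵥ a = 0) (v : Fin n → ℝ) :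
    (v ᵥ* residual Y H W b) ⬝ᵥ (v ᵥ* residual Y H W b) ≤ M * (lamH * lamW) * (v ⬝ᵥ v) := by
  have hM' : (0 : ℝ) < M := Nat.cast_pos.mpr hM
  have hWR := h.transpose_mul_residual hM
  set R := residual Y H W b with hR
  have haH : a ᵥ* H = 0 := by
    have h1 : a ᵥ* (Wᵀ * R) = 0 := by
      rw [← vecMul_vecMul, vecMul_transpose, hWa, zero_vecMul]
    rw [hWR, vecMul_smul, neg_smul, neg_eq_zero] at h1
    exact (smul_eq_zero.mp h1).resolve_left hlamH.ne'
  set w := v ᵥ* R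
  set q := a ⬝ᵥ a
  have hq : 0 < q := by
    refine lt_of_le_of_ne ?_ fun hq => ha (dotProduct_self_eq_zero.mp hq.symm)
    exact Finset.sum_nonneg fun i _ => mul_self_nonneg _
  have hRw : v ⬝ᵥ R *ᵥ w = w ⬝ᵥ w := dotProduct_mulVec _ _ _
  have key : 0 ≤ q * lamH / (2 * M) * (M * (lamH * lamW) * (v ⬝ᵥ v) - w ⬝ᵥ w) := by
    refine nonneg_of_forall_nonneg
      (B := 1 / (2 * (M : ℝ)) * (lamH ^ 2 * q ^ 2 * ((v ⬝ᵥ v) * (w ⬝ᵥ w)))) fun t => ?_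
    -- As `a` annihilates both `W` and `H`, the residual changes only through the product of the two
    -- perturbations, at order `t²`. The factor `lamH` makes the `t²` coefficient a positive
    -- multiple of `M c |v|² - |w|²`.
    have h1 := h.variation_nonneg (-t • vecMulVec a w) ((t * lamH) • vecMulVec v a) 0
      (D := (-(t ^ 2 * lamH * q)) • vecMulVec v w) (by
        simp only [Matrix.mul_smul, mul_vecMulVec, hWa, Matrix.smul_mul, vecMulVec_mul, haH,
          smul_mulVec, vecMulVec_mulVec, zero_vecMulVec, smul_zero, zero_add, add_zero]
        ext i j
        simp only [Matrix.add_apply, Matrix.smul_apply, Pi.zero_apply, vecMulVec_apply, smul_eq_mul, Pi.smul_apply,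
          MulOpposite.smul_eq_mul_unop, MulOpposite.unop_op]
        ring)
    simp only [transpose_smul, Matrix.mul_smul, trace_smul, frobSq_smul, smul_eq_mul,
      trace_mul_transpose_vecMulVec, frobSq_vecMulVec, ← hR, hRw, hWa, dotProduct_zero] at h1
    have h2 : a ⬝ᵥ H *ᵥ w = 0 := by rw [dotProduct_mulVec, haH, zero_dotProduct]
    rw [h2] at h1
    convert h1 using 1
    field_simp
    ring
  have h3 := nonneg_of_mul_nonneg_right key (by positivity)
  linarith

end Variation

end UFM

namespace UFM

open Matrix

/-! ### The training error of a minimizer -/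

theorem dotProduct_mul_transpose_mulVec {n M : ℕ} (R : Matrix (Fin n) (Fin M) ℝ) (v : Fin n → ℝ) :
    v ⬝ᵥ (R * Rᵀ) *ᵥ v = (v ᵥ* R) ⬝ᵥ (v ᵥ* R) := by
  rw [← mulVec_mulVec, dotProduct_mulVec, mulVec_transpose]

section Minimizer

variable {n d M : ℕ} {lamH lamW : ℝ} {Y : Matrix (Fin n) (Fin M) ℝ}
  {H : Matrix (Fin d) (Fin M) ℝ} {W : Matrix (Fin n) (Fin d) ℝ} {b : Fin n → ℝ}

/-- The rows of `R` sum to zero, hence so do those of `H` because `lamH ≠ 0`; this makes `b` the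
vector of target means. -/
theorem IsOptimal.centered_eq (h : IsOptimal lamH lamW Y H W b) (hM : 0 < M)
    (hlamH : 0 < lamH) : centered Y = W * H - residual Y H W b := by
  have hM' : (M : ℝ) ≠ 0 := Nat.cast_ne_zero.mpr hM.ne'
  have hR1 := h.residual_mulVec_one hM
  have hH1 : H *ᵥ 1 = 0 := by
    have h1 : (Wᵀ * residual Y H W b) *ᵥ 1 = 0 := by rw [← mulVec_mulVec, hR1, mulVec_zero]
    rw [h.transpose_mul_residual hM, smul_mulVec, neg_smul, neg_eq_zero] at h1
    exact (smul_eq_zero.mp h1).resolve_left hlamH.ne'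
  have hb : ∀ i, b i = targetMean Y i := by
    intro i
    have h1 := congrFun hR1 i
    rw [residual, sub_mulVec, add_mulVec, ← mulVec_mulVec, hH1, mulVec_zero, zero_add] at h1
    simp only [Pi.sub_apply, mulVec, dotProduct, vecMulVec_apply, Pi.one_apply, mul_one,
      Finset.sum_const, Finset.card_univ, Fintype.card_fin, nsmul_eq_mul, Pi.zero_apply] at h1
    rw [targetMean, ← sub_eq_zero.mp h1, inv_mul_cancel_left₀ hM']
  ext i j
  simp only [centered, of_apply, residual, Matrix.sub_apply, Matrix.add_apply, vecMulVec_apply,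
    Pi.one_apply, mul_one, hb]
  ring

theorem IsOptimal.residual_sq_mul (h : IsOptimal lamH lamW Y H W b) (hM : 0 < M) :
    ((M : ℝ)⁻¹ • (residual Y H W b * (residual Y H W b)ᵀ)) * W = (lamH * lamW) • W := by
  have hM' : (M : ℝ) ≠ 0 := Nat.cast_ne_zero.mpr hM.ne'
  have h1 : (residual Y H W b)ᵀ * W = -lamH • Hᵀ := by
    rw [← transpose_smul, ← h.transpose_mul_residual hM, transpose_mul, transpose_transpose]
  rw [Matrix.smul_mul, Matrix.mul_assoc, h1, Matrix.mul_smul, h.residual_mul_transpose hM,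
    smul_smul, smul_smul]
  congr 1
  field_simp

/-- If `W` has a kernel, this is the second-order condition. Otherwise `n ≤ d` forces `W` to be
square and invertible, and `S W = c W` gives `S = c`. -/
theorem IsOptimal.residual_sq_le (h : IsOptimal lamH lamW Y H W b) (hM : 0 < M) (hd : n ≤ d)
    (hlamH : 0 < lamH) (v : Fin n → ℝ) :
    v ⬝ᵥ ((M : ℝ)⁻¹ • (residual Y H W b * (residual Y H W b)ᵀ)) *ᵥ v ≤
      lamH * lamW * (v ⬝ᵥ v) := by
  have hM' : (0 : ℝ) < M := Nat.cast_pos.mpr hM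
  by_cases hker : ∃ a, a ≠ 0 ∧ W *ᵥ a = 0
  · obtain ⟨a, ha, hWa⟩ := hker
    have h1 := h.residual_le_of_mulVec_eq_zero hM hlamH ha hWa v
    rw [smul_mulVec, dotProduct_smul, dotProduct_mul_transpose_mulVec, smul_eq_mul, inv_mul_le_iff₀ hM']
    linarith
  · have hinj : Function.Injective W.mulVecLin := by
      rw [← LinearMap.ker_eq_bot, LinearMap.ker_eq_bot']
      intro a ha
      by_contra hne
      exact hker ⟨a, hne, ha⟩
    have hdn : d ≤ n := by
      simpa using LinearMap.finrank_le_finrank_of_injective hinj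
    have hsurj : Function.Surjective W.mulVecLin :=
      (LinearMap.injective_iff_surjective_of_finrank_eq_finrank
        (by simpa using le_antisymm hdn hd)).mp hinj
    obtain ⟨x, rfl⟩ := hsurj v
    rw [mulVecLin_apply, mulVec_mulVec, h.residual_sq_mul hM, smul_mulVec, dotProduct_smul,
      smul_eq_mul]

theorem IsOptimal.mse_eq_of_pos (h : IsOptimal lamH lamW Y H W b) (hM : 0 < M) (hd : n ≤ d)
    (hlamH : 0 < lamH) (hlamW : 0 ≤ lamW) :
    mse Y H W b = ∑ k, min ((sampleCov_isHermitian Y).eigenvalues k) (lamH * lamW) := by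
  have hM' : (0 : ℝ) < M := Nat.cast_pos.mpr hM
  have hRH := h.residual_mul_transpose hM
  -- Expand the square of `W H - R`: each of the two cross terms contributes `lamW • W Wᵀ`.
  have hcov : sampleCov Y = W * ((M : ℝ)⁻¹ • (H * Hᵀ) + (2 * lamW) • 1) * Wᵀ +
      (M : ℝ)⁻¹ • (residual Y H W b * (residual Y H W b)ᵀ) := by
    have hHR : H * (residual Y H W b)ᵀ = -((M : ℝ) * lamW) • Wᵀ := by
      rw [← transpose_smul, ← hRH, transpose_mul, transpose_transpose]
    have h1 : W * H * (residual Y H W b)ᵀ = -((M : ℝ) * lamW) • (W * Wᵀ) := by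
      rw [Matrix.mul_assoc, hHR, Matrix.mul_smul]
    have h2 : residual Y H W b * (W * H)ᵀ = -((M : ℝ) * lamW) • (W * Wᵀ) := by
      rw [transpose_mul, ← Matrix.mul_assoc, hRH, Matrix.smul_mul]
    rw [sampleCov, h.centered_eq hM hlamH, transpose_sub, Matrix.mul_sub, Matrix.sub_mul,
      Matrix.sub_mul, h1, h2, Matrix.mul_add, Matrix.add_mul, Matrix.mul_smul, Matrix.smul_mul,
      Matrix.mul_smul, Matrix.smul_mul, Matrix.mul_one, transpose_mul]
    simp only [Matrix.mul_assoc, smul_sub, smul_smul]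
    rw [show (M : ℝ)⁻¹ * -((M : ℝ) * lamW) = -lamW by field_simp]
    module
  rw [← trace_eq_sum_min_of_complementary (sampleCov_isHermitian Y) hcov ?_ ?_ ?_
    (h.residual_sq_le hM hd hlamH) ?_]
  · rw [trace_smul, ← frobSq_eq_trace, mse, one_div, smul_eq_mul]
  · simp [transpose_mul, Matrix.mul_assoc]
  · simp [transpose_mul]
  · intro v
    have h1 : v ⬝ᵥ (W * ((M : ℝ)⁻¹ • (H * Hᵀ) + (2 * lamW) • 1) * Wᵀ) *ᵥ v =
        (M : ℝ)⁻¹ * ((v ᵥ* (W * H)) ⬝ᵥ (v ᵥ* (W * H))) +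
          2 * lamW * ((v ᵥ* W) ⬝ᵥ (v ᵥ* W)) := by
      rw [← dotProduct_mul_transpose_mulVec, ← dotProduct_mul_transpose_mulVec, Matrix.mul_add, Matrix.add_mul,
        Matrix.mul_smul, Matrix.smul_mul, Matrix.mul_smul, Matrix.smul_mul, Matrix.mul_one,
        transpose_mul, add_mulVec, dotProduct_add, smul_mulVec, smul_mulVec, dotProduct_smul,
        dotProduct_smul, smul_eq_mul, smul_eq_mul]
      simp only [Matrix.mul_assoc]
    rw [h1]
    have h2 : ∀ {m : ℕ} (w : Fin m → ℝ), 0 ≤ w ⬝ᵥ w := fun w =>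
      Finset.sum_nonneg fun i _ => mul_self_nonneg _
    have h3 := h2 (v ᵥ* (W * H))
    have h4 := h2 (v ᵥ* W)
    positivity
  · rw [Matrix.mul_assoc W, ← Matrix.mul_assoc _ W, h.residual_sq_mul hM, Matrix.smul_mul]

theorem eigenvalues_sampleCov_nonneg (Y : Matrix (Fin n) (Fin M) ℝ) (k : Fin n) :
    0 ≤ (sampleCov_isHermitian Y).eigenvalues k := by
  have h : (sampleCov Y).PosSemidef := by
    rw [sampleCov, ← conjTranspose_eq_transpose_of_trivial]
    exact (posSemidef_self_mul_conjTranspose _).smul (by positivity)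
  exact h.eigenvalues_nonneg k

theorem mse_nonneg : 0 ≤ mse Y H W b :=
  mul_nonneg (by positivity) (frobSq_nonneg _)

theorem nonpos_of_forall_sq_mul_le {x K : ℝ} (h : ∀ s : ℝ, s ≠ 0 → s ^ 2 * x ≤ K) : x ≤ 0 := by
  by_contra hx
  rw [not_le] at hx
  have hs : 1 ≤ |K| / x + 1 := le_add_of_nonneg_left (by positivity)
  have h1 := h (|K| / x + 1) (by linarith)
  have h2 : |K| / x * x = |K| := div_mul_cancel₀ _ hx.ne'
  nlinarith [le_abs_self K, mul_le_mul_of_nonneg_right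
    (le_mul_of_one_le_left (zero_le_one.trans hs) hs) hx.le]

/-- The factors `t W₀` and `t⁻¹ W₀ᵀ Y` fit exactly for every `t ≠ 0`. Sending `t` to `0` or `∞`
shifts all the size into a factor that is not penalized. -/
theorem IsOptimal.mse_eq_zero (h : IsOptimal lamH lamW Y H W b) (hd : n ≤ d)
    (hlamH : 0 ≤ lamH) (hlamW : 0 ≤ lamW) (hc : lamH * lamW = 0) : mse Y H W b = 0 := by
  refine le_antisymm ?_ mse_nonneg
  -- First `n` rows of the `d × d` identity, available because `n ≤ d`.
  set W₀ : Matrix (Fin n) (Fin d) ℝ := (1 : Matrix (Fin d) (Fin d) ℝ).submatrix (Fin.castLE hd) id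
  have hW₀ : W₀ * W₀ᵀ = 1 := by
    ext i j
    simp [W₀, mul_apply, one_apply, eq_comm]
  have hfit : ∀ t : ℝ, t ≠ 0 → mse Y H W b ≤
      lamH / M * ((t⁻¹) ^ 2 * frobSq (W₀ᵀ * Y)) + lamW * (t ^ 2 * frobSq W₀) := by
    intro t ht
    have h1 := h (t⁻¹ • (W₀ᵀ * Y)) (t • W₀) 0
    have h2 : residual Y (t⁻¹ • (W₀ᵀ * Y)) (t • W₀) 0 = 0 := by
      rw [residual, Matrix.smul_mul, Matrix.mul_smul, smul_smul, mul_inv_cancel₀ ht, one_smul,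
        ← Matrix.mul_assoc, hW₀, Matrix.one_mul, zero_vecMulVec, add_zero, sub_self]
    simp only [loss, h2, frobSq_zero, frobSq_smul] at h1
    have h3 : 0 ≤ lamH / (2 * (M : ℝ)) * frobSq H :=
      mul_nonneg (by positivity) (frobSq_nonneg _)
    have h4 : 0 ≤ lamW / 2 * frobSq W := mul_nonneg (by positivity) (frobSq_nonneg _)
    have h5 : mse Y H W b = 2 * (1 / (2 * (M : ℝ)) * frobSq (residual Y H W b)) := by
      rw [mse]; ring
    have h6 : lamH / (M : ℝ) = 2 * (lamH / (2 * M)) := by ring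
    rw [h5, h6]
    linarith
  rcases mul_eq_zero.mp hc with h0 | h0
  · refine nonpos_of_forall_sq_mul_le (K := lamW * frobSq W₀) fun s hs => ?_
    have h1 := hfit s⁻¹ (inv_ne_zero hs)
    rw [h0, zero_div, zero_mul, zero_add] at h1
    calc s ^ 2 * mse Y H W b ≤ s ^ 2 * (lamW * (s⁻¹ ^ 2 * frobSq W₀)) :=
          mul_le_mul_of_nonneg_left h1 (sq_nonneg s)
      _ = lamW * frobSq W₀ := by field_simp
  · refine nonpos_of_forall_sq_mul_le (K := lamH / M * frobSq (W₀ᵀ * Y)) fun s hs => ?_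
    have h1 := hfit s hs
    rw [h0, zero_mul, add_zero] at h1
    calc s ^ 2 * mse Y H W b ≤ s ^ 2 * (lamH / M * (s⁻¹ ^ 2 * frobSq (W₀ᵀ * Y))) :=
          mul_le_mul_of_nonneg_left h1 (sq_nonneg s)
      _ = lamH / M * frobSq (W₀ᵀ * Y) := by field_simp

/-- The training error of a global minimizer: every eigenvalue of the sample covariance
contributes its part below the threshold `lamH * lamW`. -/
theorem IsOptimal.mse_eq (h : IsOptimal lamH lamW Y H W b) (hM : 0 < M) (hd : n ≤ d)
    (hlamH : 0 ≤ lamH) (hlamW : 0 ≤ lamW) :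
    mse Y H W b = ∑ k, min ((sampleCov_isHermitian Y).eigenvalues k) (lamH * lamW) := by
  rcases hlamH.lt_or_eq with h1 | h1
  · exact h.mse_eq_of_pos hM hd h1 hlamW
  · have hc : lamH * lamW = 0 := by rw [← h1, zero_mul]
    rw [h.mse_eq_zero hd hlamH hlamW hc, hc]
    exact (Finset.sum_eq_zero fun k _ => min_eq_right (eigenvalues_sampleCov_nonneg Y k)).symm

end Minimizer

/-! ### Single tasks -/

theorem sampleCov_apply_self {n M : ℕ} (Y : Matrix (Fin n) (Fin M) ℝ) (i : Fin n) :
    sampleCov Y i i = taskVariance Y i := by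
  simp [sampleCov, taskVariance, mul_apply, centered, sq]

theorem eigenvalues_taskTargets {n M : ℕ} (Y : Matrix (Fin n) (Fin M) ℝ) (i : Fin n)
    (k : Fin 1) :
    (sampleCov_isHermitian (taskTargets Y i)).eigenvalues k = taskVariance Y i := by
  have h := (sampleCov_isHermitian (taskTargets Y i)).trace_eq_sum_eigenvalues
  rw [Fin.sum_univ_one, trace_fin_one, sampleCov_apply_self] at h
  rw [Subsingleton.elim k 0]
  exact h.symm

theorem IsOptimal.mse_taskTargets_eq {n d M : ℕ} {lamH lamW : ℝ} {Y : Matrix (Fin n) (Fin M) ℝ}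
    {i : Fin n} {H : Matrix (Fin d) (Fin M) ℝ} {W : Matrix (Fin 1) (Fin d) ℝ} {b : Fin 1 → ℝ}
    (h : IsOptimal lamH lamW (taskTargets Y i) H W b) (hM : 0 < M) (hd : 1 ≤ d)
    (hlamH : 0 ≤ lamH) (hlamW : 0 ≤ lamW) :
    mse (taskTargets Y i) H W b = min (taskVariance Y i) (lamH * lamW) := by
  rw [h.mse_eq hM hd hlamH hlamW, Fin.sum_univ_one, eigenvalues_taskTargets]

/-- With no training examples the covariance is zero, of rank `0 < n`. -/
theorem pos_of_rank_sampleCov {n M : ℕ} (hn : 0 < n) {Y : Matrix (Fin n) (Fin M) ℝ}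
    (hY : (sampleCov Y).rank = n) : 0 < M := by
  rcases Nat.eq_zero_or_pos M with rfl | h
  · rw [show sampleCov Y = 0 by simp [sampleCov], rank_zero] at hY
    omega
  · exact h

end UFM
-- Comparison of the two models
theorem theorem4p2 {n d d' M : ℕ} (hn : 0 < n) (hd : n ≤ d) (hd' : 1 ≤ d')
    -- the targets, with sample covariance matrix of full rank
    (Y : Matrix (Fin n) (Fin M) ℝ) (hY : (UFM.sampleCov Y).rank = n)
    -- regularization parameters of the multi-task model and of the single-task models
    (lamH lamW lamHt lamWt c ct : ℝ)
    (hlamH : 0 ≤ lamH) (hlamW : 0 ≤ lamW) (hlamHt : 0 ≤ lamHt) (hlamWt : 0 ≤ lamWt)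
    (hc : c = lamH * lamW) (hct : ct = lamHt * lamWt)
    -- an optimal solution of the multi-task model
    (H : Matrix (Fin d) (Fin M) ℝ) (W : Matrix (Fin n) (Fin d) ℝ) (b : Fin n → ℝ)
    (hopt : UFM.IsOptimal lamH lamW Y H W b)
    -- an optimal solution of each single-task model
    (Hs : Fin n → Matrix (Fin d') (Fin M) ℝ) (Ws : Fin n → Matrix (Fin 1) (Fin d') ℝ)
    (bs : Fin n → (Fin 1 → ℝ))
    (hopts : ∀ i, UFM.IsOptimal lamHt lamWt (UFM.taskTargets Y i) (Hs i) (Ws i) (bs i))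
    (lamMax lamMin mseMulti mseSingle : ℝ) (jstar kstar : ℕ)
    (hlamMax : lamMax = UFM.eigs Y ⟨0, hn⟩)
    (hlamMin : lamMin = UFM.eigs Y ⟨n - 1, Nat.sub_lt hn Nat.one_pos⟩)
    (hmulti : mseMulti = UFM.mse Y H W b)
    (hsingle : mseSingle = ∑ i, UFM.mse (UFM.taskTargets Y i) (Hs i) (Ws i) (bs i))
    (hjstar : jstar = UFM.lastIndexGE (UFM.eigs Y) c)
    (hkstar : kstar = UFM.lastIndexGE (UFM.sortedVariances Y) ct) :
    (ct = c →
      mseMulti ≤ mseSingle ∧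
      (lamMin < c → c < lamMax → jstar < kstar → mseMulti < mseSingle) ∧
      (0 < c → c < lamMin → mseMulti = mseSingle) ∧
      (lamMax < c → mseMulti = mseSingle)) ∧
    (c < ct →
      mseMulti ≤ mseSingle ∧
      (c < min ct lamMax → mseMulti < mseSingle) ∧
      (lamMax < c → mseMulti = mseSingle)) := by 
  have hM := UFM.pos_of_rank_sampleCov hn hY
  set l := (UFM.sampleCov_isHermitian Y).eigenvalues
  set a := UFM.taskVariance Y
  have hm : mseMulti = ∑ k, min (l k) c := by
    rw [hmulti, hc]
    exact hopt.mse_eq hM hd hlamH hlamW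
  have hs : mseSingle = ∑ i, min (a i) ct := by
    rw [hsingle, hct]
    exact Finset.sum_congr rfl fun i _ => (hopts i).mse_taskTargets_eq hM hd' hlamHt hlamWt
  obtain ⟨p, hp, hrow, hcol, hdiag⟩ :=
    UFM.exists_doublyStochastic_diag_eq (UFM.sampleCov_isHermitian Y)
  have ha : ∀ i, a i = ∑ k, p i k * l k := fun i => by
    rw [← hdiag, UFM.sampleCov_apply_self]
  have hmax : ∀ k, l k ≤ lamMax := fun k => hlamMax ▸ UFM.le_sortDesc_zero hn l k
  have hmin : ∀ k, lamMin ≤ l k := fun k => hlamMin ▸ UFM.sortDesc_last_le hn l k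
  have hamax : ∀ i, a i ≤ lamMax := fun i => by
    rw [ha]
    calc ∑ k, p i k * l k ≤ ∑ k, p i k * lamMax :=
          Finset.sum_le_sum fun k _ => mul_le_mul_of_nonneg_left (hmax k) (hp i k)
      _ = lamMax := by rw [← Finset.sum_mul, hrow, one_mul]
  have hamin : ∀ i, lamMin ≤ a i := fun i => by
    rw [ha]
    calc lamMin = ∑ k, p i k * lamMin := by rw [← Finset.sum_mul, hrow, one_mul]
      _ ≤ ∑ k, p i k * l k :=
          Finset.sum_le_sum fun k _ => mul_le_mul_of_nonneg_left (hmin k) (hp i k)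
  have hle : ∀ t, ∑ k, min (l k) t ≤ ∑ i, min (a i) t :=
    UFM.sum_min_le_sum_min hp hrow hcol ha
  -- Above `lamMax` nothing is truncated, and both sums are the trace of the covariance.
  have htrace : ∀ {s t : ℝ}, lamMax < s → lamMax < t →
      ∑ k, min (l k) s = ∑ i, min (a i) t := by
    intro s t hs ht
    rw [Finset.sum_congr rfl fun k _ => min_eq_left ((hmax k).trans hs.le),
      Finset.sum_congr rfl fun i _ => min_eq_left ((hamax i).trans ht.le),
      ← UFM.sum_sum_mul_eq hcol, Finset.sum_congr rfl fun i _ => ha i]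
  rw [hm, hs]
  refine ⟨?_, fun hlt => ⟨?_, ?_, fun h => htrace h (h.trans hlt)⟩⟩
  · rintro rfl
    refine ⟨hle ct, fun _ _ hjk => ?_, fun _ h => ?_, fun h => htrace h h⟩
    · refine (hle ct).lt_of_ne fun heq => ?_
      rw [hjstar, hkstar, UFM.eigs, UFM.sortedVariances, UFM.lastIndexGE_sortDesc,
        UFM.lastIndexGE_sortDesc] at hjk
      exact hjk.not_ge (UFM.card_le_card_of_sum_min_eq hp hrow hcol ha heq)
    -- Below `lamMin` every term on either side is truncated to the threshold.
    · exact Finset.sum_congr rfl fun k _ => by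
        rw [min_eq_right (h.le.trans (hmin k)), min_eq_right (h.le.trans (hamin k))]
  · exact (Finset.sum_le_sum fun k _ => min_le_min le_rfl hlt.le).trans (hle ct)
  · intro h
    refine lt_of_lt_of_le (Finset.sum_lt_sum (fun k _ => min_le_min le_rfl hlt.le) ?_) (hle ct)
    -- The unsorted index of the largest eigenvalue: its term rises from `c` to `min ct lamMax`.
    refine ⟨Tuple.sort l (Fin.rev ⟨0, hn⟩), Finset.mem_univ _, ?_⟩
    have htop : l (Tuple.sort l (Fin.rev ⟨0, hn⟩)) = lamMax := hlamMax.symm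
    rw [htop, min_eq_right (h.le.trans (min_le_right _ _)), min_comm]
    exact h
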